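/- Let $k$ be an algebraically closed field of characteristic zero. A fusion category over $k$ is a $k$-linear abelian semisimple rigid monoidal category with bilinear tensor product, finite-dimensional morphism spaces, finitely many simple objects up to isomorphism, and simple unit object $\mathbf 1$. For a fusion category $\mathcal C$ let $\mathrm{Irr}(\mathcal C)$ be the set of isomorphism classes of simple objects; for $X\in\mathrm{Irr}(\mathcal C)$ let $\mathrm{FPdim}(X)$ be the largest nonnegative real eigenvalue of the matrix of left multiplication by $[X]$ in the basis $\mathrm{Irr}(\mathcal C)$ of the Grothendieck ring. Let $G(\mathcal C)$ be the group of isomorphism classes of invertible objects (simple $X$ with $X\otimes X^*\cong\mathbf 1$), let $\mathcal C_{ad}$ be the smallest fusion subcategory containing all simple constituents of $X\otimes X^*$ for all simple $X$, and let $\mathcal U(\mathcal C)$ be the universal grading group, i.e. the group generated by $\mathrm{Irr}(\mathcal C)$ with relations $[X][Y]=[Z]$ whenever $Z$ is a simple constituent of $X\otimes Y$. A Yang–Lee category is a fusion category with exactly two simple objects $\mathbf 1, X$ up to isomorphism, such that $X\otimes X\cong\mathbf 1\oplus X$. Let $G$ be a group and let $\mathcal C=\bigoplus_{g\in G}\mathcal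 C_g$ be a fusion category over $k$ with a faithful $G$-grading (that is, $\mathcal C_g\otimes\mathcal C_h\subseteq\mathcal C_{gh}$ and $\mathcal C_g\neq 0$ for all $g,h\in G$) whose trivial component $\mathcal C_e$ is identified, by a $k$-linear monoidal equivalence, with a Yang–Lee category $\mathcal Y$. Put $n=|G(\mathcal C)|$. Then: (1) $\mathcal C$ is of type $(1,n;\frac{1+\sqrt5}{2},n)$: every simple object has Frobenius–Perron dimension $1$ or $\frac{1+\sqrt5}{2}$, and up to isomorphism there are exactly $n$ simple objects of each of these two dimensions. (2) For every $g\in G$ the component $\mathcal C_g$ has exactly two simple objects $\delta_g,Y_g$ up to isomorphism; $\delta_g$ is invertible, $\mathrm{FPdim}(\delta_g)=1$ and $\mathrm{FPdim}(Y_g)=\frac{1+\sqrt5}{2}$. (3) $\mathcal Y=\mathcal C_{ad}$ (as subcategories of $\mathcal C$); $G=\mathcal U(\mathcal C)$, that is, there is a group isomorphism $\varphi:\mathcal U(\mathcal C)\to G$ such that a simple object $X$ lies in $\mathcal C_g$ if and only if $\varphi([X])=g$; and $|\mathcal U(\mathcal C)|=n$. -/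

import Mathlib

open CategoryTheory CategoryTheory.Limits MonoidalCategory

namespace Fusion

universe w v u

attribute [local instance] Abelian.hasFiniteBiproducts

/-- A fusion category over `k`: the typeclass arguments say that `C` is a `k`-linear abelian rigid
monoidal category with bilinear tensor product; the fields say that it is semisimple with
finite-dimensional morphism spaces, finitely many simple objects up to isomorphism, and simple
unit. -/
class IsFusionCategory (k : Type w) [Field k] (C : Type u) [Category.{v} C] [Abelian C]
    [Linear k C] [MonoidalCategory C] [MonoidalPreadditive C] [MonoidalLinear k C]
    [RigidCategory C] : Prop where
  finiteDimensional_hom : ∀ X Y : C, FiniteDimensional k (X ⟶ Y)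
  semisimple : ∀ X : C, ∃ (m : ℕ) (S : Fin m → C), (∀ i, Simple (S i)) ∧ Nonempty (X ≅ ⨁ S)
  finite_simples : ∃ (m : ℕ) (S : Fin m → C), ∀ X : C, Simple X → ∃ i, Nonempty (X ≅ S i)
  simple_unit : Simple (𝟙_ C)

section Irr

variable (C : Type u) [Category.{v} C] [HasZeroMorphisms C]

/-- Isomorphism of simple objects. -/
def simpleSetoid : Setoid {X : C // Simple X} where
  r X Y := Nonempty (X.1 ≅ Y.1)
  iseqv :=
    { refl := fun X => ⟨Iso.refl X.1⟩
      symm := fun ⟨e⟩ => ⟨e.symm⟩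
      trans := fun ⟨e⟩ ⟨f⟩ => ⟨e.trans f⟩ }

/-- `Irr(C)`: the set of isomorphism classes of simple objects. -/
def Irr : Type u := Quotient (simpleSetoid C)

variable {C}

/-- A representative of an isomorphism class of simple objects. -/
noncomputable def Irr.obj (x : Irr C) : C := (Quotient.out (s := simpleSetoid C) x).1

/-- `S` is a simple constituent of `X`: a simple object which is a subobject of `X`. -/
def IsSimpleConstituent (S X : C) : Prop := Simple S ∧ ∃ f : S ⟶ X, Mono f

end Irr

theorem finite_irr (k : Type w) [Field k] (C : Type u) [Category.{v} C] [Abelian C]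
    [Linear k C] [MonoidalCategory C] [MonoidalPreadditive C] [MonoidalLinear k C]
    [RigidCategory C] [h : IsFusionCategory k C] : Finite (Irr C) := by
  obtain ⟨m, S, hS⟩ := h.finite_simples
  choose i hi using fun x : Irr C => hS x.obj (Quotient.out (s := simpleSetoid C) x).2
  refine Finite.of_injective i fun x y hxy => ?_
  obtain ⟨e⟩ := hi x
  obtain ⟨f⟩ := hi y
  rw [← hxy] at f
  exact Quotient.out_equiv_out.1 ⟨e.trans f.symm⟩

section FPdim

variable (k : Type w) [Field k] {C : Type u} [Category.{v} C] [Abelian C] [Linear k C]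
  [MonoidalCategory C]

/-- The matrix of left multiplication by the class `x` in the basis `Irr(C)` of the Grothendieck
ring: the entry in row `z` and column `y` is the multiplicity of `z` in `x ⊗ y`. -/
noncomputable def leftMulMatrix (x : Irr C) : Matrix (Irr C) (Irr C) ℝ :=
  fun z y => (Module.finrank k (z.obj ⟶ x.obj ⊗ y.obj) : ℝ)

/-- The Frobenius–Perron dimension of a simple object: the largest nonnegative real eigenvalue of
the matrix of left multiplication by its class. -/
noncomputable def FPdim [MonoidalPreadditive C] [MonoidalLinear k C] [RigidCategory C]
    [IsFusionCategory k C] (x : Irr C) : ℝ :=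
  haveI := finite_irr k C
  letI := Fintype.ofFinite (Irr C)
  sSup {r : ℝ | 0 ≤ r ∧ ∃ v : Irr C → ℝ, v ≠ 0 ∧ (leftMulMatrix k x).mulVec v = r • v}

/-- `C` is of type `(d 0, n 0; …; d s, n s)`, where `1 = d 0 < ⋯ < d s` and the `n i` are positive:
the Frobenius–Perron dimensions of the simple objects are the numbers `d i`, and there are exactly
`n i` isomorphism classes of simple objects of dimension `d i`. -/
structure IsOfType (C : Type u) [Category.{v} C] [Abelian C] [Linear k C]
    [MonoidalCategory C] [MonoidalPreadditive C] [MonoidalLinear k C] [RigidCategory C]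
    [IsFusionCategory k C] {s : ℕ} (d : Fin (s + 1) → ℝ) (n : Fin (s + 1) → ℕ) : Prop where
  dim_zero : d 0 = 1
  dim_strictMono : StrictMono d
  mult_pos : ∀ i, 0 < n i
  card_eq : ∀ i, Nat.card {x : Irr C // FPdim k x = d i} = n i
  exhaust : ∀ x : Irr C, ∃ i, FPdim k x = d i

/-- A Yang–Lee category: a fusion category with exactly two simple objects `𝟙`, `X` up to
isomorphism, such that `X ⊗ X ≅ 𝟙 ⊕ X`. -/
def IsYangLee (C : Type u) [Category.{v} C] [Abelian C] [Linear k C]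
    [MonoidalCategory C] [MonoidalPreadditive C] [MonoidalLinear k C] [RigidCategory C] : Prop :=
  IsFusionCategory k C ∧ ∃ X : C, Simple X ∧ IsEmpty (X ≅ 𝟙_ C) ∧
    (∀ S : C, Simple S → Nonempty (S ≅ 𝟙_ C) ∨ Nonempty (S ≅ X)) ∧
    Nonempty (X ⊗ X ≅ 𝟙_ C ⊞ X)

end FPdim

section Subcategories

variable (C : Type u) [Category.{v} C] [Abelian C] [MonoidalCategory C]

/-- The set underlying the group `G(C)` of isomorphism classes of invertible objects: the classes of
those simple objects `X` for which `X ⊗ X* ≅ 𝟙`. -/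
def invertibles [RigidCategory C] : Set (Irr C) :=
  {x | Nonempty (x.obj ⊗ HasRightDual.rightDual x.obj ≅ 𝟙_ C)}

variable {C}

/-- Fusion subcategories, as full replete subcategories: closed under tensor products, duals,
finite direct sums and direct summands, and containing the unit. -/
structure IsFusionSubcategory [RigidCategory C] (P : ObjectProperty C) : Prop where
  iso : ∀ {X Y : C}, (X ≅ Y) → P X → P Y
  unit : P (𝟙_ C)
  tensor : ∀ {X Y : C}, P X → P Y → P (X ⊗ Y)
  rightDual : ∀ {X : C}, P X → P (HasRightDual.rightDual X)
  leftDual : ∀ {X : C}, P X → P (HasLeftDual.leftDual X)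
  zero : ∀ {X : C}, IsZero X → P X
  biprod : ∀ {X Y : C}, P X → P Y → P (X ⊞ Y)
  summand : ∀ {X Y : C}, P (X ⊞ Y) → P X

variable (C) in
/-- The adjoint subcategory `C_ad`: the smallest fusion subcategory containing all simple
constituents of `X ⊗ X*`, for all simple `X`. -/
def adjointSubcategory [RigidCategory C] : ObjectProperty C := fun Z =>
  ∀ P : ObjectProperty C, IsFusionSubcategory P →
    (∀ X S : C, Simple X → IsSimpleConstituent S (X ⊗ HasRightDual.rightDual X) → P S) → P Z

/-- A grading `C = ⊕_{g ∈ G} C_g` by a group `G`: full replete subcategories `C_g` with no nonzero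
morphisms between different ones, such that each object is a finite direct sum of homogeneous
objects and `⊗` maps `C_g × C_h` to `C_{gh}`. (Closure of each `C_g` under direct sums and summands
follows from these conditions.) -/
structure Grading (C : Type u) [Category.{v} C] [Abelian C] [MonoidalCategory C]
    (G : Type w) [Group G] where
  component : G → ObjectProperty C
  iso : ∀ {g : G} {X Y : C}, (X ≅ Y) → component g X → component g Y
  zero : ∀ (g : G) {X : C}, IsZero X → component g X
  hom_eq_zero : ∀ {g h : G} {X Y : C}, g ≠ h → component g X → component h Y →
    ∀ f : X ⟶ Y, f = 0
  decomposition : ∀ X : C, ∃ (s : Finset G) (Z : s → C),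
    (∀ g : s, component g.1 (Z g)) ∧ Nonempty (X ≅ ⨁ Z)
  tensor : ∀ {g h : G} {X Y : C}, component g X → component h Y → component (g * h) (X ⊗ Y)

/-- A grading is faithful if all its components are nonzero. -/
def Grading.IsFaithful {G : Type w} [Group G] (𝒢 : Grading C G) : Prop :=
  ∀ g : G, ∃ X : C, 𝒢.component g X ∧ ¬ IsZero X

/-- `Irr(C_g)`: the classes of simple objects lying in the component of degree `g`. -/
def Grading.irr {G : Type w} [Group G] (𝒢 : Grading C G) (g : G) : Set (Irr C) :=
  {x | 𝒢.component g x.obj}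

variable (C)

/-- The universal grading group `U(C)`: generated by the classes of simple objects, with a relation
`[x] [y] = [z]` for every simple constituent `z` of `x ⊗ y`. It is the universal target of
gradings of `C`. -/
def UniversalGradingGroup : Type u :=
  PresentedGroup {r : FreeGroup (Irr C) | ∃ x y z : Irr C,
    IsSimpleConstituent z.obj (x.obj ⊗ y.obj) ∧
      r = FreeGroup.of x * FreeGroup.of y * (FreeGroup.of z)⁻¹}

instance : Group (UniversalGradingGroup C) :=
  inferInstanceAs (Group (PresentedGroup _))

variable {C}

/-- The degree of a simple object in the universal grading. -/
def universalDegree (x : Irr C) : UniversalGradingGroup C :=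
  PresentedGroup.of x

end Subcategories

end Fusion

/-! By semisimplicity everything reduces to dimensions of Hom spaces, written `homDim`. Let `T` be
the image in `C` of the nontrivial simple object of `Y`; it has degree 1, satisfies `T ⊗ T ≅ 𝟙 ⊞ T`,
and is self-dual, so `T ⊗ -` is self-adjoint.

For simple `X`, the object `X ⊗ Xᘁ` has degree 1 and contains `𝟙` exactly once, so `X` is invertible
iff `T` does not occur in it, iff `X` does not occur in `T ⊗ X` (`invertible_iff`). If `X` is not
invertible, `T ⊗ X` has a constituent other than `X`, since `n² = n + 1` has no integer solution,
and comparing multiplicities shows that this constituent is invertible (`exists_invertible`). Hence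
every component contains an invertible `D`; translating by `Dᘁ` to degree 1 shows that its simple
objects are `D` and `T ⊗ D`.

The values 1 on `D` and φ on `T ⊗ D` form a common positive eigenvector of all left multiplication
matrices, so they are the Frobenius–Perron dimensions. Since `T` occurs in `T ⊗ T`, its class in the
universal grading group is trivial, so universal degree depends only on degree. `T` also occurs in
`T ⊗ Tᘁ`, so it generates the trivial component inside `C_ad`. -/

namespace Fusion

universe w v u

attribute [local instance] Abelian.hasFiniteBiproducts

/-! ### Dimensions of Hom spaces and duality -/

section Hom

variable (k : Type w) [Field k] {C : Type u} [Category.{v} C] [Abelian C] [Linear k C]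

/-- The dimension of the space of morphisms from `A` to `B`. -/
noncomputable def homDim (A B : C) : ℕ := Module.finrank k (A ⟶ B)

variable {k} in
theorem homDim_congr {A A' B B' : C} (e : A ≅ A') (f : B ≅ B') : homDim k A B = homDim k A' B' :=
  LinearEquiv.finrank_eq (Linear.homCongr k e f)

theorem homDim_congr_left {A A' : C} (e : A ≅ A') (B : C) : homDim k A B = homDim k A' B :=
  homDim_congr e (Iso.refl B)

theorem homDim_congr_right (A : C) {B B' : C} (e : B ≅ B') : homDim k A B = homDim k A B' :=
  homDim_congr (Iso.refl A) e

variable {k} in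
theorem exists_ne_zero_of_homDim_ne_zero {A B : C} (h : homDim k A B ≠ 0) :
    ∃ f : A ⟶ B, f ≠ 0 := by
  by_contra! hf
  have : Subsingleton (A ⟶ B) := ⟨fun f g => by rw [hf f, hf g]⟩
  exact h Module.finrank_zero_of_subsingleton

theorem homDim_eq_zero {A B : C} (h : ∀ f : A ⟶ B, f = 0) : homDim k A B = 0 := by
  by_contra h'
  obtain ⟨f, hf⟩ := exists_ne_zero_of_homDim_ne_zero h'
  exact hf (h f)

variable {k} in
theorem nonempty_iso_of_homDim_ne_zero {X Y : C} [Simple X] [Simple Y] (hf : homDim k X Y ≠ 0) :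
    Nonempty (X ≅ Y) := by
  obtain ⟨f, hf⟩ := exists_ne_zero_of_homDim_ne_zero hf
  have := isIso_of_hom_simple hf
  exact ⟨asIso f⟩

theorem homDim_simple_of_isEmpty {X Y : C} [Simple X] [Simple Y] (hf : IsEmpty (X ≅ Y)) :
    homDim k X Y = 0 := by
  by_contra h'
  exact not_nonempty_iff.2 hf (nonempty_iso_of_homDim_ne_zero h')

variable {k} in
theorem isSimpleConstituent_of_homDim {S X : C} [hS : Simple S] (h : homDim k S X ≠ 0) :
    IsSimpleConstituent S X := by
  obtain ⟨f, hf⟩ := exists_ne_zero_of_homDim_ne_zero h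
  exact ⟨hS, f, mono_of_nonzero_from_simple hf⟩

section Monoidal

variable [MonoidalCategory C] [MonoidalPreadditive C] [MonoidalLinear k C]

/-- The duality adjunction between `Y' ⊗ -` and `Y ⊗ -` is built from whiskering and composition,
hence is linear. -/
theorem homDim_tensorLeft (A B Y Y' : C) [ExactPairing Y Y'] :
    homDim k (Y' ⊗ A) B = homDim k A (Y ⊗ B) := by
  refine LinearEquiv.finrank_eq
    { tensorLeftHomEquiv A Y Y' B with
      map_add' := fun f g => ?_
      map_smul' := fun r f => ?_ }
  · simp [tensorLeftHomEquiv]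
  · simp [tensorLeftHomEquiv]

theorem homDim_tensorRight (A B Y Y' : C) [ExactPairing Y Y'] :
    homDim k (A ⊗ Y) B = homDim k A (B ⊗ Y') := by
  refine LinearEquiv.finrank_eq
    { tensorRightHomEquiv A Y Y' B with
      map_add' := fun f g => ?_
      map_smul' := fun r f => ?_ }
  · simp [tensorRightHomEquiv]
  · simp [tensorRightHomEquiv]

end Monoidal

theorem homDim_map {D : Type*} [Category* D] [Preadditive D] [Linear k D] {E : Type*} [Category* E]
    [Abelian E] [Linear k E] (F : D ⥤ E) [F.Additive] [F.Linear k] [F.Full] [F.Faithful]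
    (A B : D) : Module.finrank k (A ⟶ B) = homDim k (F.obj A) (F.obj B) :=
  LinearEquiv.finrank_eq (LinearEquiv.ofBijective (F.mapLinearMap k)
    ⟨F.map_injective, F.map_surjective⟩)

end Hom

/-! ### Multiplicities and simplicity in semisimple categories -/

section Semisimple

variable (k : Type w) [Field k] {C : Type u} [Category.{v} C] [Abelian C]
    [Linear k C] [MonoidalCategory C] [MonoidalPreadditive C] [MonoidalLinear k C]
    [RigidCategory C] [h : IsFusionCategory k C]

theorem homDim_biprod_left (A B X : C) :
    homDim k (A ⊞ B) X = homDim k A X + homDim k B X := by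
  have := h.finiteDimensional_hom
  unfold homDim
  rw [← Module.finrank_prod]
  refine LinearEquiv.finrank_eq
    { toFun := fun f => (biprod.inl ≫ f, biprod.inr ≫ f)
      invFun := fun p => biprod.desc p.1 p.2
      map_add' := fun f g => by simp
      map_smul' := fun r f => by simp
      left_inv := fun f => by ext <;> simp
      right_inv := fun p => by simp }

theorem homDim_biproduct_left {n : ℕ} (S : Fin n → C) (X : C) :
    homDim k (⨁ S) X = ∑ i, homDim k (S i) X := by
  have := h.finiteDimensional_hom
  unfold homDim
  rw [← Module.finrank_pi_fintype]
  refine LinearEquiv.finrank_eq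
    { toFun := fun f i => biproduct.ι S i ≫ f
      invFun := fun p => biproduct.desc p
      map_add' := fun f g => by ext; simp
      map_smul' := fun r f => by ext; simp
      left_inv := fun f => by ext; simp
      right_inv := fun p => by ext; simp }

theorem homDim_biproduct_right {n : ℕ} (X : C) (S : Fin n → C) :
    homDim k X (⨁ S) = ∑ i, homDim k X (S i) := by
  have := h.finiteDimensional_hom
  unfold homDim
  rw [← Module.finrank_pi_fintype]
  refine LinearEquiv.finrank_eq
    { toFun := fun f i => f ≫ biproduct.π S i
      invFun := fun p => biproduct.lift p
      map_add' := fun f g => by ext; simp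
      map_smul' := fun r f => by ext; simp
      left_inv := fun f => by ext; simp
      right_inv := fun p => by ext; simp }

-- Finite-dimensionality is essential: `finrank` takes the default value 0 on infinite-dimensional
-- spaces.
variable {k} in
theorem homDim_ne_zero {A B : C} {f : A ⟶ B} (hf : f ≠ 0) : homDim k A B ≠ 0 := by
  have := h.finiteDimensional_hom
  have : Nontrivial (A ⟶ B) := ⟨f, 0, hf⟩
  exact Module.finrank_pos.ne'

theorem homDim_simple_self [IsAlgClosed k] (X : C) [Simple X] : homDim k X X = 1 := by
  have := h.finiteDimensional_hom
  exact finrank_endomorphism_simple_eq_one k X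

/-- In a fusion category, objects with one-dimensional endomorphism algebra are simple. -/
theorem simple_of_homDim_self {X : C} (hX : homDim k X X = 1) : Simple X := by
  obtain ⟨n, S, hS, ⟨e⟩⟩ := h.semisimple X
  rw [homDim_congr_left k e, homDim_biproduct_left] at hX
  -- Each summand contributes its own inclusion, so a total of 1 leaves room for only one summand.
  have hpos : ∀ i, 1 ≤ homDim k (S i) X := fun i => by
    have := hS i
    rw [homDim_congr_right k _ e, Nat.one_le_iff_ne_zero]
    refine homDim_ne_zero (f := biproduct.ι S i) fun h0 => id_nonzero (S i) ?_
    rw [← biproduct.ι_π_self S i, h0, zero_comp]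
  have hn : n ≤ 1 := by
    calc n = ∑ _i : Fin n, 1 := by simp
      _ ≤ _ := Finset.sum_le_sum fun i _ => hpos i
      _ = 1 := hX
  interval_cases n
  · simp at hX
  · have := hS default
    exact Simple.of_iso (e.trans (biproductUniqueIso S))

end Semisimple

/-- In a fusion category, every nonzero object has a simple subobject. -/
theorem exists_simple_mono (k : Type w) [Field k] {C : Type u} [Category.{v} C] [Abelian C]
    [Linear k C] [MonoidalCategory C] [MonoidalPreadditive C] [MonoidalLinear k C]
    [RigidCategory C] [h : IsFusionCategory k C] {X : C} (hX : ¬ IsZero X) :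
    ∃ (S : C) (f : S ⟶ X), Simple S ∧ Mono f := by
  obtain ⟨n, S, hS, ⟨e⟩⟩ := h.semisimple X
  rcases n with _ | n
  · refine absurd ((IsZero.iff_id_eq_zero _).2 ?_) (fun hZ => hX (hZ.of_iso e))
    ext i
    exact i.elim0
  · exact ⟨S 0, biproduct.ι S 0 ≫ e.inv, hS 0, mono_comp _ _⟩

/-! ### Finite direct sums and isomorphism classes of simple objects -/

section Biproduct

variable {C : Type u} [Category.{v} C] [Abelian C]

/-- Splitting off the first summand of a finite direct sum. -/
noncomputable def biproductSuccIso {n : ℕ} (S : Fin (n + 1) → C) :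
    S 0 ⊞ (⨁ fun i : Fin n => S i.succ) ≅ ⨁ S where
  hom := biprod.desc (biproduct.ι S 0) (biproduct.desc fun i => biproduct.ι S i.succ)
  inv := biprod.lift (biproduct.π S 0) (biproduct.lift fun i => biproduct.π S i.succ)
  hom_inv_id := by
    ext i j
    · simp
    · simp [biproduct.ι_π_ne _ (Fin.succ_ne_zero _).symm]
    · simp [biproduct.ι_π_ne _ (Fin.succ_ne_zero _)]
    · by_cases hij : i = j
      · subst hij; simp
      · simp [biproduct.ι_π_ne _ hij, biproduct.ι_π_ne _ (fun e => hij (Fin.succ_injective _ e))]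
  inv_hom_id := by
    rw [biprod.lift_desc, biproduct.lift_desc, ← biproduct.total, Fin.sum_univ_succ]

theorem IsFusionSubcategory.biproduct [MonoidalCategory C] [RigidCategory C]
    {P : ObjectProperty C} (hP : IsFusionSubcategory P) :
    ∀ {n : ℕ} (S : Fin n → C), (∀ i, P (S i)) → P (⨁ S)
  | 0, S, _ => hP.zero ((IsZero.iff_id_eq_zero _).2 (by ext i; exact i.elim0))
  | _ + 1, S, h => hP.iso (biproductSuccIso S)
      (hP.biprod (h 0) (hP.biproduct _ fun i => h i.succ))

end Biproduct

section IrrMk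

variable {C : Type u} [Category.{v} C] [HasZeroMorphisms C]

/-- The isomorphism class of a simple object. -/
def Irr.mk (X : C) (hX : Simple X) : Irr C := Quotient.mk (simpleSetoid C) ⟨X, hX⟩

instance Irr.simple_obj (x : Irr C) : Simple x.obj := (Quotient.out (s := simpleSetoid C) x).2

theorem Irr.nonempty_mk_obj_iso (X : C) (hX : Simple X) : Nonempty ((Irr.mk X hX).obj ≅ X) :=
  Quotient.mk_out (s := simpleSetoid C) ⟨X, hX⟩

theorem Irr.eq_of_iso {x y : Irr C} (e : x.obj ≅ y.obj) : x = y :=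
  Quotient.out_equiv_out.1 ⟨e⟩

theorem Irr.mk_eq_iff {X : C} {hX : Simple X} {x : Irr C} :
    x = Irr.mk X hX ↔ Nonempty (x.obj ≅ X) := by
  obtain ⟨e⟩ := Irr.nonempty_mk_obj_iso X hX
  constructor
  · rintro rfl
    exact ⟨e⟩
  · rintro ⟨f⟩
    exact Irr.eq_of_iso (f.trans e.symm)

end IrrMk

/-! ### Homogeneous objects: subobjects and duals -/

namespace Grading

variable {C : Type u} [Category.{v} C] [Abelian C] [MonoidalCategory C] {G : Type*} [Group G]
  (𝒢 : Grading C G)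

theorem eq_of_component {g h : G} {X : C} (hX : ¬ IsZero X) (hg : 𝒢.component g X)
    (hh : 𝒢.component h X) : g = h := by
  by_contra hne
  exact hX ((IsZero.iff_id_eq_zero X).2 (𝒢.hom_eq_zero hne hg hh _))

/-- The component of degree `g` consists of the objects receiving no nonzero morphism from the
other components. -/
theorem component_of_orthogonal {g : G} {W : C}
    (hW : ∀ h, h ≠ g → ∀ V, 𝒢.component h V → ∀ f : V ⟶ W, f = 0) : 𝒢.component g W := by
  obtain ⟨s, Z, hZ, ⟨e⟩⟩ := 𝒢.decomposition W
  -- The inclusion of a summand of another degree is zero by `hW`, and it is split, so the summand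
  -- vanishes.
  have hzero : ∀ j : s, j.1 ≠ g → IsZero (Z j) := fun j hj => by
    have h0 := hW j.1 hj (Z j) (hZ j) (biproduct.ι Z j ≫ e.inv)
    rw [IsZero.iff_id_eq_zero, ← biproduct.ι_π_self Z j]
    have : biproduct.ι Z j = 0 := by simpa using congrArg (· ≫ e.hom) h0
    rw [this, zero_comp]
  by_cases hg : g ∈ s
  · refine 𝒢.iso (e.symm) (𝒢.iso (X := Z ⟨g, hg⟩) ⟨biproduct.ι Z _, biproduct.π Z _, ?_, ?_⟩
      (hZ ⟨g, hg⟩))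
    · simp
    · refine biproduct.hom_ext' _ _ fun j => ?_
      by_cases hj : j = ⟨g, hg⟩
      · subst hj
        simp
      · exact (hzero j fun e => hj (Subtype.ext e)).eq_of_src _ _
  · refine 𝒢.iso e.symm (𝒢.zero g ((IsZero.iff_id_eq_zero _).2 ?_))
    refine biproduct.hom_ext' _ _ fun j => (hzero j ?_).eq_of_src _ _
    rintro rfl
    exact hg j.2

theorem component_of_mono {g : G} {A W : C} (f : A ⟶ W) [Mono f] (hW : 𝒢.component g W) :
    𝒢.component g A :=
  𝒢.component_of_orthogonal fun _ hh _ hV a => by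
    rw [← cancel_mono f, zero_comp]
    exact 𝒢.hom_eq_zero hh hV hW _

theorem exists_component_of_simple (S : C) [Simple S] : ∃ g, 𝒢.component g S := by
  obtain ⟨s, Z, hZ, ⟨e⟩⟩ := 𝒢.decomposition S
  by_contra! hS
  refine Simple.not_isZero S (IsZero.of_iso ((IsZero.iff_id_eq_zero _).2 ?_) e)
  refine biproduct.hom_ext' _ _ fun j => ?_
  by_contra hj
  have hj' : biproduct.ι Z j ≫ e.inv ≠ 0 := fun h0 => hj (by
    have := congrArg (· ≫ e.hom) h0
    simpa using this)
  have := isIso_of_mono_of_nonzero hj'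
  exact hS j.1 (𝒢.iso (asIso (biproduct.ι Z j ≫ e.inv)) (hZ j))

section Dual

variable [MonoidalPreadditive C] [RigidCategory C]

/-- A map `V ⟶ Xᘁ` corresponds to a map `V ⊗ X ⟶ 𝟙`, which vanishes unless the degree of `V` is
`g⁻¹`. -/
theorem component_rightDual (h1 : 𝒢.component 1 (𝟙_ C)) {g : G} {X : C} (hX : 𝒢.component g X) :
    𝒢.component g⁻¹ Xᘁ :=
  𝒢.component_of_orthogonal fun h hh V hV f => by
    have hf : (tensorRightHomEquiv V X Xᘁ (𝟙_ C)).symm (f ≫ (λ_ _).inv) = 0 :=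
      𝒢.hom_eq_zero (fun e => hh (eq_inv_of_mul_eq_one_left e)) (𝒢.tensor hV hX) h1 _
    rw [Equiv.symm_apply_eq] at hf
    simpa [tensorRightHomEquiv] using congrArg (· ≫ (λ_ _).hom) hf

theorem component_leftDual (h1 : 𝒢.component 1 (𝟙_ C)) {g : G} {X : C} (hX : 𝒢.component g X) :
    𝒢.component g⁻¹ (ᘁX) :=
  𝒢.component_of_orthogonal fun h hh V hV f => by
    have hf : (tensorLeftHomEquiv V (ᘁX) X (𝟙_ C)).symm (f ≫ (ρ_ _).inv) = 0 :=
      𝒢.hom_eq_zero (fun e => hh (eq_inv_of_mul_eq_one_right e)) (𝒢.tensor hX hV) h1 _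
    rw [Equiv.symm_apply_eq] at hf
    simpa [tensorLeftHomEquiv] using congrArg (· ≫ (ρ_ _).hom) hf

/-- The trivial component of a grading is a fusion subcategory. -/
theorem isFusionSubcategory_component_one (h1 : 𝒢.component 1 (𝟙_ C)) :
    IsFusionSubcategory (𝒢.component 1) where
  iso e h := 𝒢.iso e h
  unit := h1
  tensor hX hY := by simpa using 𝒢.tensor hX hY
  rightDual hX := by simpa using 𝒢.component_rightDual h1 hX
  leftDual hX := by simpa using 𝒢.component_leftDual h1 hX
  zero h := 𝒢.zero 1 h
  biprod hX hY := 𝒢.component_of_orthogonal fun _ hh _ hV f => by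
    ext
    · simpa using 𝒢.hom_eq_zero hh hV hX (f ≫ biprod.fst)
    · simpa using 𝒢.hom_eq_zero hh hV hY (f ≫ biprod.snd)
  summand h := 𝒢.component_of_mono biprod.inl h

end Dual

end Grading

/-! ### The Yang–Lee object and the invertibility criterion -/

/-- The trivial component of the grading has exactly the simple objects `𝟙` and `T`, and
`T ⊗ T ≅ 𝟙 ⊕ T`. -/
structure IsYangLeeObject (k : Type w) [Field k] {C : Type u} [Category.{v} C] [Abelian C]
    [Linear k C] [MonoidalCategory C] {G : Type*} [Group G] (𝒢 : Grading C G) (T : C) : Prop where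
  simple : Simple T
  homDim_unit : homDim k T (𝟙_ C) = 0
  tensor_self : Nonempty (T ⊗ T ≅ 𝟙_ C ⊞ T)
  unit_mem : 𝒢.component 1 (𝟙_ C)
  mem : 𝒢.component 1 T
  iso_or_iso : ∀ S : C, Simple S → 𝒢.component 1 S → Nonempty (S ≅ 𝟙_ C) ∨ Nonempty (S ≅ T)

section Dual

variable (k : Type w) [Field k] {C : Type u} [Category.{v} C] [Abelian C]
  [Linear k C] [MonoidalCategory C] [MonoidalPreadditive C] [MonoidalLinear k C]
  [RigidCategory C]

theorem homDim_rightDual_self (X : C) : homDim k Xᘁ Xᘁ = homDim k X X := by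
  rw [homDim_congr_right k _ (λ_ Xᘁ).symm, ← homDim_tensorRight k Xᘁ (𝟙_ C) X Xᘁ,
    homDim_tensorLeft k X (𝟙_ C) X Xᘁ, homDim_congr_right k _ (ρ_ X)]

variable {k} in
theorem homDim_tensor_invertible {X : C} (e : X ⊗ Xᘁ ≅ 𝟙_ C) (A B : C) :
    homDim k (A ⊗ X) (B ⊗ X) = homDim k A B := by
  rw [homDim_tensorRight k _ _ X Xᘁ,
    homDim_congr_right k _ ((α_ _ _ _).trans ((whiskerLeftIso B e).trans (ρ_ _)))]

variable {k} in
theorem homDim_invertible_tensor {X : C} (e : Xᘁ ⊗ X ≅ 𝟙_ C) (A B : C) :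
    homDim k (X ⊗ A) (X ⊗ B) = homDim k A B := by
  rw [← homDim_tensorLeft k _ _ X Xᘁ,
    homDim_congr_left k ((α_ _ _ _).symm.trans ((whiskerRightIso e A).trans (λ_ _)))]

end Dual

/-- `X* ⊗ X ≅ 𝟙` for an invertible object `X`. -/
theorem nonempty_rightDual_tensor_iso (k : Type w) [Field k] [IsAlgClosed k]
    {C : Type u} [Category.{v} C] [Abelian C] [Linear k C] [MonoidalCategory C] [MonoidalPreadditive C] [MonoidalLinear k C]
    [RigidCategory C] [hC : IsFusionCategory k C]
    (X : C) [Simple X] (e : X ⊗ Xᘁ ≅ 𝟙_ C) :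
    Nonempty (Xᘁ ⊗ X ≅ 𝟙_ C) := by
  -- Moving the last `X` across turns endomorphisms of `Xᘁ ⊗ X` into maps `Xᘁ ⟶ Xᘁ ⊗ (X ⊗ Xᘁ) ≅ Xᘁ`.
  have hsimple : Simple (Xᘁ ⊗ X) := simple_of_homDim_self k (by
    rw [homDim_tensorRight k _ _ X Xᘁ,
      homDim_congr_right k _ ((α_ _ _ _).trans ((whiskerLeftIso Xᘁ e).trans (ρ_ _))),
      homDim_rightDual_self, homDim_simple_self])
  have := hC.simple_unit
  refine nonempty_iso_of_homDim_ne_zero (k := k) ?_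
  rw [homDim_tensorRight k _ _ X Xᘁ, homDim_congr_right k _ (λ_ _), homDim_rightDual_self,
    homDim_simple_self]
  exact one_ne_zero

namespace IsYangLeeObject

variable {k : Type w} [Field k] {C : Type u} [Category.{v} C] [Abelian C]
  [Linear k C] [MonoidalCategory C] [MonoidalPreadditive C] [MonoidalLinear k C]
  [RigidCategory C] [hC : IsFusionCategory k C] {G : Type*} [Group G] {𝒢 : Grading C G} {T : C}

theorem homDim_tensor_self (hT : IsYangLeeObject k 𝒢 T) (Z : C) :
    homDim k (T ⊗ T) Z = homDim k (𝟙_ C) Z + homDim k T Z := by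
  obtain ⟨e⟩ := hT.tensor_self
  rw [homDim_congr_left k e, homDim_biprod_left]

/-- This is `T² = 1 + T` applied to `X`; moving `X` across by duality avoids distributing `⊗` over
the direct sum. -/
theorem homDim_tensor_tensor (hT : IsYangLeeObject k 𝒢 T) (X Z : C) :
    homDim k (T ⊗ (T ⊗ X)) Z = homDim k X Z + homDim k (T ⊗ X) Z := by
  rw [homDim_congr_left k (α_ T T X).symm, homDim_tensorRight k _ _ X Xᘁ,
    hT.homDim_tensor_self, ← homDim_tensorRight k _ _ X, ← homDim_tensorRight k _ _ X,
    homDim_congr_left k (λ_ X)]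

variable [IsAlgClosed k]

/-- Maps `T ⟶ ᘁT` correspond to maps `T ⊗ T ⟶ 𝟙`, and `T ⊗ T` contains `𝟙`. -/
theorem nonempty_iso_leftDual (hT : IsYangLeeObject k 𝒢 T) : Nonempty (T ≅ ᘁT) := by
  have := hT.simple
  have := hC.simple_unit
  have : Simple (ᘁT) := simple_of_homDim_self k (by
    rw [homDim_congr_right k _ (ρ_ (ᘁT)).symm, ← homDim_tensorLeft k _ _ (ᘁT) T,
      homDim_tensorRight k _ _ (ᘁT) T, homDim_congr_right k _ (λ_ T), homDim_simple_self])
  refine nonempty_iso_of_homDim_ne_zero (k := k) ?_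
  rw [homDim_congr_right k _ (ρ_ (ᘁT)).symm, ← homDim_tensorLeft k _ _ (ᘁT) T,
    hT.homDim_tensor_self, homDim_simple_self]
  omega

/-- Self-duality of `T` makes `T ⊗ -` self-adjoint on the level of multiplicities. -/
theorem homDim_tensor_comm (hT : IsYangLeeObject k 𝒢 T) (X Z : C) :
    homDim k (T ⊗ X) Z = homDim k X (T ⊗ Z) := by
  obtain ⟨e⟩ := hT.nonempty_iso_leftDual
  rw [homDim_tensorLeft k _ _ (ᘁT) T, homDim_congr_right k _ (whiskerRightIso e Z)]

/-- Invertibility of a simple object `X` is detected by the multiplicity of `X` in `T ⊗ X`. -/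
theorem invertible_iff (hT : IsYangLeeObject k 𝒢 T) (X : C) [Simple X] :
    Nonempty (X ⊗ Xᘁ ≅ 𝟙_ C) ↔ homDim k (T ⊗ X) X = 0 := by
  rw [homDim_tensorRight k T X X Xᘁ]
  constructor
  · rintro ⟨e⟩
    rw [homDim_congr_right k _ e, hT.homDim_unit]
  · intro h0
    have := hC.simple_unit
    have := hT.simple
    obtain ⟨g, hg⟩ := 𝒢.exists_component_of_simple X
    -- Degree 1 allows only the constituents `𝟙` and `T`; `h0` excludes `T`, and `𝟙` occurs once.
    have hmem : 𝒢.component 1 (X ⊗ Xᘁ) := by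
      simpa using 𝒢.tensor hg (𝒢.component_rightDual hT.unit_mem hg)
    have h1 : homDim k (𝟙_ C) (X ⊗ Xᘁ) = 1 := by
      rw [← homDim_tensorRight k _ _ X Xᘁ, homDim_congr_left k (λ_ X), homDim_simple_self]
    obtain ⟨n, S, hS, ⟨e⟩⟩ := hC.semisimple (X ⊗ Xᘁ)
    have hS1 : ∀ i, Nonempty (S i ≅ 𝟙_ C) := fun i => by
      have := hS i
      refine (hT.iso_or_iso (S i) (hS i)
        (𝒢.component_of_mono (biproduct.ι S i ≫ e.inv) hmem)).resolve_right ?_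
      rintro ⟨a⟩
      have hne : biproduct.ι S i ≫ e.inv ≠ 0 := fun hz => id_nonzero (S i) (by
        have := congrArg (fun f => f ≫ e.hom ≫ biproduct.π S i) hz
        simpa using this)
      exact homDim_ne_zero (k := k) hne (by rw [homDim_congr_left k a, h0])
    have hn : n = 1 := by
      rw [homDim_congr_right k _ e, homDim_biproduct_right,
        Finset.sum_congr rfl fun i _ => homDim_congr_right k _ (hS1 i).some] at h1
      simpa [homDim_simple_self] using h1
    subst hn
    exact ⟨e.trans ((biproductUniqueIso S).trans (hS1 _).some)⟩

end IsYangLeeObject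

/-! ### Perron–Frobenius comparison -/

/-- The Perron–Frobenius eigenvalue of a nonnegative matrix is detected by a positive
eigenvector. -/
theorem sSup_eigenvalues_eq {ι : Type*} [Fintype ι] {M : Matrix ι ι ℝ} (hM : ∀ i j, 0 ≤ M i j)
    {d : ι → ℝ} (hd : ∀ i, 0 < d i) {r : ℝ} (hr : 0 ≤ r) [Nonempty ι] (hMd : M.mulVec d = r • d) :
    sSup {s : ℝ | 0 ≤ s ∧ ∃ v : ι → ℝ, v ≠ 0 ∧ M.mulVec v = s • v} = r := by
  refine IsGreatest.csSup_eq ⟨⟨hr, d, ?_, hMd⟩, ?_⟩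
  · intro h0
    exact (hd (Classical.arbitrary ι)).ne' (congrFun h0 _)
  · rintro s ⟨hs, v, hv, hMv⟩
    -- Scale `d` until it dominates `|v|` and touches it at `i`; row `i` of the eigenvalue equations
    -- then gives `s ≤ r`.
    obtain ⟨i, -, hi⟩ := Finset.exists_max_image Finset.univ (fun j => |v j| / d j)
      Finset.univ_nonempty
    have hle : ∀ j, |v j| ≤ |v i| / d i * d j := fun j =>
      (div_le_iff₀ (hd j)).1 (hi j (Finset.mem_univ j))
    have hpos : 0 < |v i| := by
      rw [abs_pos]
      intro h0
      refine hv (funext fun j => ?_)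
      have := hle j
      rw [h0, abs_zero, zero_div, zero_mul] at this
      exact abs_nonpos_iff.1 this
    have hmain : s * |v i| ≤ r * |v i| := by
      calc s * |v i| = |(M.mulVec v) i| := by
            rw [hMv, Pi.smul_apply, smul_eq_mul, abs_mul, abs_of_nonneg hs]
        _ ≤ ∑ j, |M i j * v j| := Finset.abs_sum_le_sum_abs _ _
        _ ≤ ∑ j, |v i| / d i * (M i j * d j) := Finset.sum_le_sum fun j _ => by
            rw [abs_mul, abs_of_nonneg (hM i j)]
            calc M i j * |v j| ≤ M i j * (|v i| / d i * d j) :=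
                  mul_le_mul_of_nonneg_left (hle j) (hM i j)
              _ = _ := by ring
        _ = |v i| / d i * (M.mulVec d) i := by rw [← Finset.mul_sum]; rfl
        _ = r * |v i| := by
            rw [hMd, Pi.smul_apply, smul_eq_mul]
            field_simp [(hd i).ne']
    exact le_of_mul_le_mul_right hmain hpos

/-! ### Simple objects in each component -/

namespace IsYangLeeObject

variable {k : Type w} [Field k] [IsAlgClosed k] {C : Type u} [Category.{v} C] [Abelian C]
  [Linear k C] [MonoidalCategory C] [MonoidalPreadditive C] [MonoidalLinear k C]
  [RigidCategory C] [hC : IsFusionCategory k C] {G : Type*} [Group G] {𝒢 : Grading C G} {T : C}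

/-- Every component of a faithful grading contains an invertible object. -/
theorem exists_invertible (hT : IsYangLeeObject k 𝒢 T) (h𝒢 : 𝒢.IsFaithful) (g : G) :
    ∃ D : C, Simple D ∧ 𝒢.component g D ∧ homDim k (T ⊗ D) D = 0 := by
  obtain ⟨W, hWg, hW⟩ := h𝒢 g
  obtain ⟨X, a, hX, ha⟩ := exists_simple_mono k hW
  have hXg := 𝒢.component_of_mono a hWg
  by_cases hm : homDim k (T ⊗ X) X = 0
  · exact ⟨X, hX, hXg, hm⟩
  obtain ⟨n, S, hS, ⟨e⟩⟩ := hC.semisimple (T ⊗ X)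
  have hsum : ∀ Z, homDim k (T ⊗ X) Z = ∑ i, homDim k (S i) Z := fun Z => by
    rw [homDim_congr_left k e, homDim_biproduct_left]
  have hTX : ∀ Z, homDim k (T ⊗ X) (T ⊗ Z) = homDim k X Z + homDim k (T ⊗ X) Z := fun Z => by
    rw [← hT.homDim_tensor_comm, hT.homDim_tensor_tensor]
  -- Otherwise `T ⊗ X` is `n` copies of `X`, and `T² = 1 + T` forces `n² = n + 1`.
  obtain ⟨j, hj⟩ : ∃ j, IsEmpty (S j ≅ X) := by
    by_contra! hall
    have hsum' : ∀ Z, homDim k (T ⊗ X) Z = n * homDim k X Z := fun Z => by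
      rw [hsum, Finset.sum_congr rfl fun i _ => homDim_congr_left k (hall i).some Z]
      simp
    have h1 := hTX X
    rw [hsum', ← hT.homDim_tensor_comm, hsum', homDim_simple_self, mul_one] at h1
    rcases n with _ | _ | n
    · omega
    · omega
    · nlinarith
  have := hS j
  obtain ⟨i, hi⟩ : ∃ i, homDim k (S i) X ≠ 0 := by
    by_contra! hall
    exact hm (by rw [hsum, Finset.sum_eq_zero fun i _ => hall i])
  have := hS i
  obtain ⟨f⟩ := nonempty_iso_of_homDim_ne_zero hi
  have hij : i ≠ j := by
    rintro rfl
    exact hj.false f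
  refine ⟨S j, hS j, 𝒢.component_of_mono (biproduct.ι S j ≫ e.inv)
    (by simpa using 𝒢.tensor hT.mem hXg), ?_⟩
  -- As `S j` is not `X`, Hom from `T ⊗ X` to `T ⊗ S j` has the same dimension as Hom to `S j`. The
  -- summand `S i ≅ X` already accounts for all of it, so nothing is left for maps `S j ⟶ T ⊗ S j`.
  have h2 := hTX (S j)
  rw [homDim_simple_of_isEmpty k ⟨fun e' => hj.false e'.symm⟩, zero_add, hsum] at h2
  have h3 : homDim k (S i) (T ⊗ S j) + homDim k (S j) (T ⊗ S j) ≤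
      ∑ l, homDim k (S l) (T ⊗ S j) := by
    rw [← Finset.sum_pair (f := fun l => homDim k (S l) (T ⊗ S j)) hij]
    exact Finset.sum_le_sum_of_subset (Finset.subset_univ _)
  rw [h2, homDim_congr_left k f, ← hT.homDim_tensor_comm, ← hT.homDim_tensor_comm] at h3
  omega

section Component

variable {D : C} [Simple D] {g : G}

theorem homDim_tensor_right (hT : IsYangLeeObject k 𝒢 T) (hD0 : homDim k (T ⊗ D) D = 0) (A B : C) :
    homDim k (A ⊗ D) (B ⊗ D) = homDim k A B := by
  obtain ⟨e⟩ := (hT.invertible_iff D).2 hD0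
  exact homDim_tensor_invertible e A B

theorem homDim_tensor_left (hT : IsYangLeeObject k 𝒢 T) (hD0 : homDim k (T ⊗ D) D = 0) (A B : C) :
    homDim k (D ⊗ A) (D ⊗ B) = homDim k A B := by
  obtain ⟨e⟩ := (hT.invertible_iff D).2 hD0
  obtain ⟨f⟩ := nonempty_rightDual_tensor_iso k D e
  exact homDim_invertible_tensor f A B

theorem homDim_tensor_tensor_self (hT : IsYangLeeObject k 𝒢 T) (hD0 : homDim k (T ⊗ D) D = 0) :
    homDim k (T ⊗ D) (T ⊗ D) = 1 := by
  have := hT.simple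
  rw [hT.homDim_tensor_right hD0, homDim_simple_self]

theorem simple_tensor (hT : IsYangLeeObject k 𝒢 T) (hD0 : homDim k (T ⊗ D) D = 0) :
    Simple (T ⊗ D) :=
  simple_of_homDim_self k (hT.homDim_tensor_tensor_self hD0)

/-- Its role is to show that `T ⊗ D` fails the invertibility criterion. -/
theorem homDim_tensor_tensor_tensor (hT : IsYangLeeObject k 𝒢 T)
    (hD0 : homDim k (T ⊗ D) D = 0) : homDim k (T ⊗ (T ⊗ D)) (T ⊗ D) = 1 := by
  rw [hT.homDim_tensor_tensor, hT.homDim_tensor_tensor_self hD0, ← hT.homDim_tensor_comm, hD0]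

/-- The simple objects in the component of an invertible object `D` are `D` and `T ⊗ D`. -/
theorem iso_or_iso_of_component (hT : IsYangLeeObject k 𝒢 T) (hD0 : homDim k (T ⊗ D) D = 0)
    (hD : 𝒢.component g D) {X : C} [Simple X] (hX : 𝒢.component g X) :
    Nonempty (X ≅ D) ∨ Nonempty (X ≅ T ⊗ D) := by
  obtain ⟨e⟩ := (hT.invertible_iff D).2 hD0
  obtain ⟨f⟩ := nonempty_rightDual_tensor_iso k D e
  -- `X` is recovered from its translate `X ⊗ Dᘁ`, a simple object of degree 1, hence `𝟙` or `T`.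
  let a : X ≅ (X ⊗ Dᘁ) ⊗ D := (ρ_ X).symm.trans ((whiskerLeftIso X f.symm).trans (α_ _ _ _).symm)
  have hs : Simple (X ⊗ Dᘁ) := simple_of_homDim_self k (by
    rw [← homDim_tensorRight k _ _ D Dᘁ, homDim_congr_left k a.symm, homDim_simple_self])
  have hmem : 𝒢.component 1 (X ⊗ Dᘁ) := by
    simpa using 𝒢.tensor hX (𝒢.component_rightDual hT.unit_mem hD)
  exact (hT.iso_or_iso _ hs hmem).imp
    (fun ⟨b⟩ => ⟨a.trans ((whiskerRightIso b D).trans (λ_ D))⟩)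
    (fun ⟨b⟩ => ⟨a.trans (whiskerRightIso b D)⟩)

/-- `D ⊗ T` is simple of the same degree as `D`, and cannot be `D` itself, since cancelling `D`
would give a nonzero map `T ⟶ 𝟙`. -/
theorem nonempty_tensor_comm (hT : IsYangLeeObject k 𝒢 T) (hD0 : homDim k (T ⊗ D) D = 0) :
    Nonempty (D ⊗ T ≅ T ⊗ D) := by
  have := hT.simple
  obtain ⟨g, hD⟩ := 𝒢.exists_component_of_simple D
  have hs : Simple (D ⊗ T) := simple_of_homDim_self k (by
    rw [hT.homDim_tensor_left hD0, homDim_simple_self])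
  refine (hT.iso_or_iso_of_component hD0 hD
    (by simpa using 𝒢.tensor hD hT.mem)).resolve_left ?_
  rintro ⟨a⟩
  have h1 := homDim_congr_right k (D ⊗ T) (a.trans (ρ_ D).symm)
  rw [hT.homDim_tensor_left hD0, hT.homDim_tensor_left hD0, homDim_simple_self,
    hT.homDim_unit] at h1
  exact one_ne_zero h1

end Component

end IsYangLeeObject

/-! ### Frobenius–Perron dimensions -/

/-- The dimension of a simple object of a faithful extension of a Yang–Lee category. -/
noncomputable def yangLeeDim (k : Type w) [Field k] {C : Type u} [Category.{v} C] [Abelian C]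
    [Linear k C] [MonoidalCategory C] (T X : C) : ℝ :=
  if homDim k (T ⊗ X) X = 0 then 1 else Real.goldenRatio

theorem yangLeeDim_congr (k : Type w) [Field k] {C : Type u} [Category.{v} C] [Abelian C]
    [Linear k C] [MonoidalCategory C] (T : C) {X X' : C} (e : X ≅ X') :
    yangLeeDim k T X = yangLeeDim k T X' := by
  unfold yangLeeDim
  rw [homDim_congr (k := k) (whiskerLeftIso T e) e]

theorem yangLeeDim_pos (k : Type w) [Field k] {C : Type u} [Category.{v} C] [Abelian C]
    [Linear k C] [MonoidalCategory C] (T X : C) : 0 < yangLeeDim k T X := by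
  unfold yangLeeDim
  split_ifs
  · exact one_pos
  · exact Real.goldenRatio_pos

namespace IsYangLeeObject

variable {k : Type w} [Field k] [IsAlgClosed k] {C : Type u} [Category.{v} C] [Abelian C]
  [Linear k C] [MonoidalCategory C] [MonoidalPreadditive C] [MonoidalLinear k C]
  [RigidCategory C] [hC : IsFusionCategory k C] {G : Type*} [Group G] {𝒢 : Grading C G} {T : C}

theorem yangLeeDim_tensor (hT : IsYangLeeObject k 𝒢 T) {D : C} [Simple D]
    (hD0 : homDim k (T ⊗ D) D = 0) : yangLeeDim k T (T ⊗ D) = Real.goldenRatio := by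
  rw [yangLeeDim, if_neg (by rw [hT.homDim_tensor_tensor_tensor hD0]; exact one_ne_zero)]

/-- Commute `T` past `D`, then cancel `D`. -/
theorem yangLeeDim_invertible_tensor (hT : IsYangLeeObject k 𝒢 T) {D : C} [Simple D]
    (hD0 : homDim k (T ⊗ D) D = 0) (X : C) : yangLeeDim k T (D ⊗ X) = yangLeeDim k T X := by
  obtain ⟨e⟩ := hT.nonempty_tensor_comm hD0
  have : homDim k (T ⊗ (D ⊗ X)) (D ⊗ X) = homDim k (T ⊗ X) X := by
    rw [homDim_congr_left k ((α_ _ _ _).symm.trans ((whiskerRightIso e.symm X).trans (α_ _ _ _))),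
      hT.homDim_tensor_left hD0]
  unfold yangLeeDim
  rw [this]

/-- The dimensions form a common positive eigenvector of the left multiplication matrices. -/
theorem sum_homDim_mul_yangLeeDim (hT : IsYangLeeObject k 𝒢 T) (h𝒢 : 𝒢.IsFaithful)
    [Fintype (Irr C)] (x z : Irr C) :
    ∑ y : Irr C, (homDim k z.obj (x.obj ⊗ y.obj) : ℝ) * yangLeeDim k T y.obj =
      yangLeeDim k T x.obj * yangLeeDim k T z.obj := by
  obtain ⟨g, hx⟩ := 𝒢.exists_component_of_simple x.obj
  obtain ⟨l, hz⟩ := 𝒢.exists_component_of_simple z.obj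
  obtain ⟨D, hDs, hD, hD0⟩ := hT.exists_invertible h𝒢 g
  -- Only `y` of degree `g⁻¹ * l` can have `z` in `x ⊗ y`, so the sum reduces to the terms `E` and
  -- `T ⊗ E`.
  obtain ⟨E, hEs, hE, hE0⟩ := hT.exists_invertible h𝒢 (g⁻¹ * l)
  obtain ⟨p⟩ := (hT.invertible_iff D).2 hD0
  obtain ⟨c⟩ := hT.nonempty_tensor_comm hD0
  have hTE := hT.simple_tensor hE0
  have hET0 : homDim k E (T ⊗ E) = 0 := by rw [← hT.homDim_tensor_comm, hE0]
  have hET1 : homDim k E (T ⊗ (T ⊗ E)) = 1 := by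
    rw [← hT.homDim_tensor_comm, hT.homDim_tensor_tensor_self hE0]
  have hTET : homDim k (T ⊗ E) (T ⊗ (T ⊗ E)) = 1 := by
    rw [← hT.homDim_tensor_comm, hT.homDim_tensor_tensor_tensor hE0]
  obtain ⟨e₀⟩ := Irr.nonempty_mk_obj_iso E hEs
  obtain ⟨e₁⟩ := Irr.nonempty_mk_obj_iso (T ⊗ E) hTE
  have hne : Irr.mk E hEs ≠ Irr.mk (T ⊗ E) hTE := fun h => by
    obtain ⟨a⟩ := Irr.mk_eq_iff.1 h
    have := homDim_congr_right k E (a.symm.trans e₀)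
    rw [hET0, homDim_simple_self] at this
    exact zero_ne_one this
  rw [Fintype.sum_eq_add _ _ hne, yangLeeDim_congr k T e₀, yangLeeDim_congr k T e₁,
    hT.yangLeeDim_tensor hE0, homDim_congr_right k _ (whiskerLeftIso x.obj e₀),
    homDim_congr_right k _ (whiskerLeftIso x.obj e₁),
    show yangLeeDim k T E = 1 from if_pos hE0]
  swap
  · rintro y ⟨hy₀, hy₁⟩
    obtain ⟨h, hy⟩ := 𝒢.exists_component_of_simple y.obj
    rw [mul_eq_zero, Nat.cast_eq_zero]
    refine .inl (homDim_eq_zero k fun f => 𝒢.hom_eq_zero ?_ hz (𝒢.tensor hx hy) f)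
    rintro rfl
    rw [inv_mul_cancel_left] at hE
    exact (hT.iso_or_iso_of_component hE0 hE hy).elim (fun a => hy₀ (Irr.mk_eq_iff.2 a))
      (fun a => hy₁ (Irr.mk_eq_iff.2 a))
  -- Factoring `D` out of `z`, and out of `x` after commuting it past `T`, reduces the identity to
  -- multiplication by `𝟙` or `T` on `E` and `T ⊗ E`.
  let a : z.obj ≅ D ⊗ (Dᘁ ⊗ z.obj) :=
    (λ_ _).symm.trans ((whiskerRightIso p.symm _).trans (α_ _ _ _))
  have hw : Simple (Dᘁ ⊗ z.obj) := simple_of_homDim_self k (by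
    rw [homDim_tensorLeft k _ _ D Dᘁ, homDim_congr_right k _ a.symm, homDim_simple_self])
  have hwmem : 𝒢.component (g⁻¹ * l) (Dᘁ ⊗ z.obj) :=
    𝒢.tensor (𝒢.component_rightDual hT.unit_mem hD) hz
  rw [yangLeeDim_congr k T a, hT.yangLeeDim_invertible_tensor hD0]
  have hDN : ∀ y, homDim k z.obj (D ⊗ y) = homDim k (Dᘁ ⊗ z.obj) y := fun y =>
    (homDim_tensorLeft k _ _ D Dᘁ).symm
  have hφ := Real.goldenRatio_sq
  -- The only case needing an identity for φ is `x ≅ T ⊗ D` with translate `T ⊗ E`: it reads `1 + φ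
  -- = φ²`.
  rcases hT.iso_or_iso_of_component hD0 hD hx with hb | hb <;> obtain ⟨b⟩ := hb <;>
    rcases hT.iso_or_iso_of_component hE0 hE hwmem with hq | hq <;> obtain ⟨q⟩ := hq
  · rw [homDim_congr_right k _ (whiskerRightIso b _), homDim_congr_right k _ (whiskerRightIso b _),
      hDN, hDN, homDim_congr_left k q, homDim_congr_left k q, yangLeeDim_congr k T b,
      yangLeeDim_congr k T q, yangLeeDim, yangLeeDim, if_pos hD0, if_pos hE0, homDim_simple_self,
      hET0]
    norm_num
  · rw [homDim_congr_right k _ (whiskerRightIso b _), homDim_congr_right k _ (whiskerRightIso b _),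
      hDN, hDN, homDim_congr_left k q, homDim_congr_left k q, yangLeeDim_congr k T b,
      yangLeeDim_congr k T q, hT.yangLeeDim_tensor hE0, yangLeeDim, if_pos hD0,
      homDim_simple_self, hE0]
    norm_num
  · rw [homDim_congr_right k _ ((whiskerRightIso (b.trans c.symm) _).trans (α_ _ _ _)),
      homDim_congr_right k _ ((whiskerRightIso (b.trans c.symm) _).trans (α_ _ _ _)),
      hDN, hDN, homDim_congr_left k q, homDim_congr_left k q, yangLeeDim_congr k T b,
      yangLeeDim_congr k T q, hT.yangLeeDim_tensor hD0, yangLeeDim, if_pos hE0, hET0, hET1]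
    norm_num
  · rw [homDim_congr_right k _ ((whiskerRightIso (b.trans c.symm) _).trans (α_ _ _ _)),
      homDim_congr_right k _ ((whiskerRightIso (b.trans c.symm) _).trans (α_ _ _ _)),
      hDN, hDN, homDim_congr_left k q, homDim_congr_left k q, yangLeeDim_congr k T b,
      yangLeeDim_congr k T q, hT.yangLeeDim_tensor hD0, hT.yangLeeDim_tensor hE0,
      hT.homDim_tensor_tensor_self hE0, hTET]
    push_cast
    linarith

theorem FPdim_eq (hT : IsYangLeeObject k 𝒢 T) (h𝒢 : 𝒢.IsFaithful) (x : Irr C) :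
    FPdim k x = yangLeeDim k T x.obj := by
  have := finite_irr k C
  let := Fintype.ofFinite (Irr C)
  have : Nonempty (Irr C) := ⟨x⟩
  refine sSup_eigenvalues_eq (d := fun y => yangLeeDim k T y.obj) (fun _ _ => Nat.cast_nonneg _)
    (fun y => yangLeeDim_pos k T y.obj) (yangLeeDim_pos k T x.obj).le (funext fun z => ?_)
  exact hT.sum_homDim_mul_yangLeeDim h𝒢 x z

theorem mem_invertibles_iff (hT : IsYangLeeObject k 𝒢 T) (x : Irr C) :
    x ∈ invertibles C ↔ homDim k (T ⊗ x.obj) x.obj = 0 :=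
  hT.invertible_iff x.obj

theorem FPdim_eq_one_iff (hT : IsYangLeeObject k 𝒢 T) (h𝒢 : 𝒢.IsFaithful) (x : Irr C) :
    FPdim k x = 1 ↔ x ∈ invertibles C := by
  rw [hT.FPdim_eq h𝒢, hT.mem_invertibles_iff, yangLeeDim]
  split_ifs with h
  · simp [h]
  · simp [h, Real.one_lt_goldenRatio.ne']

theorem FPdim_eq_goldenRatio_iff (hT : IsYangLeeObject k 𝒢 T) (h𝒢 : 𝒢.IsFaithful) (x : Irr C) :
    FPdim k x = Real.goldenRatio ↔ x ∉ invertibles C := by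
  rw [hT.FPdim_eq h𝒢, hT.mem_invertibles_iff, yangLeeDim]
  split_ifs with h
  · simp [h, Real.one_lt_goldenRatio.ne]
  · simp [h]

/-- Each component has exactly one invertible and one noninvertible simple object. -/
theorem exists_irr_eq (hT : IsYangLeeObject k 𝒢 T) (h𝒢 : 𝒢.IsFaithful) (g : G) :
    ∃ δ y : Irr C, 𝒢.irr g = {δ, y} ∧ δ ∈ invertibles C ∧ y ∉ invertibles C ∧
      Nonempty (y.obj ≅ T ⊗ δ.obj) := by
  obtain ⟨D, hDs, hD, hD0⟩ := hT.exists_invertible h𝒢 g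
  have hTD := hT.simple_tensor hD0
  obtain ⟨e₀⟩ := Irr.nonempty_mk_obj_iso D hDs
  obtain ⟨e₁⟩ := Irr.nonempty_mk_obj_iso (T ⊗ D) hTD
  refine ⟨Irr.mk D hDs, Irr.mk (T ⊗ D) hTD, ?_, ?_, ?_,
    ⟨e₁.trans (whiskerLeftIso T e₀.symm)⟩⟩
  · ext x
    rw [Set.mem_insert_iff, Set.mem_singleton_iff, Irr.mk_eq_iff, Irr.mk_eq_iff]
    constructor
    · exact fun hx => hT.iso_or_iso_of_component hD0 hD hx
    · rintro (h | h) <;> obtain ⟨e⟩ := h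
      · exact 𝒢.iso e.symm hD
      · exact 𝒢.iso e.symm (by simpa using 𝒢.tensor hT.mem hD)
  · rw [hT.mem_invertibles_iff, homDim_congr (whiskerLeftIso T e₀) e₀, hD0]
  · rw [hT.mem_invertibles_iff, homDim_congr (whiskerLeftIso T e₁) e₁,
      hT.homDim_tensor_tensor_tensor hD0]
    exact one_ne_zero

end IsYangLeeObject

/-! ### Degrees and the universal grading group -/

section Degree

variable {C : Type u} [Category.{v} C] [Abelian C] [MonoidalCategory C] {G : Type*} [Group G]
  (𝒢 : Grading C G)

/-- The degree of a simple object in a grading. -/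
noncomputable def Grading.degree (x : Irr C) : G :=
  (𝒢.exists_component_of_simple x.obj).choose

theorem Grading.mem_irr_iff {g : G} {x : Irr C} : x ∈ 𝒢.irr g ↔ 𝒢.degree x = g := by
  have hx : 𝒢.component (𝒢.degree x) x.obj := (𝒢.exists_component_of_simple x.obj).choose_spec
  constructor
  · exact fun h => 𝒢.eq_of_component (Simple.not_isZero x.obj) hx h
  · rintro rfl
    exact hx

theorem Grading.component_degree (x : Irr C) : 𝒢.component (𝒢.degree x) x.obj :=
  𝒢.mem_irr_iff.2 rfl

theorem Grading.degree_eq_mul {x y z : Irr C} (h : IsSimpleConstituent z.obj (x.obj ⊗ y.obj)) :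
    𝒢.degree z = 𝒢.degree x * 𝒢.degree y := by
  obtain ⟨-, f, hf⟩ := h
  exact 𝒢.mem_irr_iff.1 (𝒢.component_of_mono f
    (𝒢.tensor (𝒢.component_degree x) (𝒢.component_degree y)))

/-- Degree restricts to a bijection from the classes satisfying `p` onto `G`. -/
theorem Grading.natCard_eq {p : Irr C → Prop} (hp : ∀ g, ∃! x, x ∈ 𝒢.irr g ∧ p x) :
    Nat.card {x // p x} = Nat.card G := by
  refine Nat.card_congr (Equiv.ofBijective (fun x => 𝒢.degree x.1) ⟨fun x y hxy => ?_, fun g => ?_⟩)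
  · exact Subtype.ext ((hp (𝒢.degree y.1)).unique ⟨𝒢.mem_irr_iff.2 hxy, x.2⟩
      ⟨𝒢.component_degree y.1, y.2⟩)
  · obtain ⟨x, ⟨hx, hpx⟩, -⟩ := hp g
    exact ⟨⟨x, hpx⟩, 𝒢.mem_irr_iff.1 hx⟩

theorem universalDegree_mul {x y z : Irr C} (h : IsSimpleConstituent z.obj (x.obj ⊗ y.obj)) :
    universalDegree x * universalDegree y = universalDegree z := by
  rw [← mul_inv_eq_one]
  exact PresentedGroup.one_of_mem ⟨x, y, z, h, rfl⟩

/-- The homomorphism from the universal grading group defined by a grading. -/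
noncomputable def Grading.fromUniversal : UniversalGradingGroup C →* G :=
  PresentedGroup.toGroup (f := 𝒢.degree) (by
    rintro r ⟨x, y, z, h, rfl⟩
    simp [𝒢.degree_eq_mul h])

theorem Grading.fromUniversal_universalDegree (x : Irr C) :
    𝒢.fromUniversal (universalDegree x) = 𝒢.degree x :=
  PresentedGroup.toGroup.of _

end Degree

/-! ### The type, the universal grading and the adjoint subcategory -/

namespace IsYangLeeObject

variable {k : Type w} [Field k] [IsAlgClosed k] {C : Type u} [Category.{v} C] [Abelian C]
  [Linear k C] [MonoidalCategory C] [MonoidalPreadditive C] [MonoidalLinear k C]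
  [RigidCategory C] [hC : IsFusionCategory k C] {G : Type*} [Group G] {𝒢 : Grading C G} {T : C}

theorem natCard_invertibles (hT : IsYangLeeObject k 𝒢 T) (h𝒢 : 𝒢.IsFaithful) :
    Nat.card (invertibles C) = Nat.card G :=
  𝒢.natCard_eq fun g => by
    obtain ⟨δ, y, hirr, hδ, hy, -⟩ := hT.exists_irr_eq h𝒢 g
    rw [hirr]
    refine ⟨δ, ⟨by simp, hδ⟩, ?_⟩
    rintro x ⟨rfl | rfl, hx⟩
    · rfl
    · exact absurd hx hy

theorem natCard_not_invertibles (hT : IsYangLeeObject k 𝒢 T) (h𝒢 : 𝒢.IsFaithful) :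
    Nat.card {x // x ∉ invertibles C} = Nat.card G :=
  𝒢.natCard_eq fun g => by
    obtain ⟨δ, y, hirr, hδ, hy, -⟩ := hT.exists_irr_eq h𝒢 g
    rw [hirr]
    refine ⟨y, ⟨by simp, hy⟩, ?_⟩
    rintro x ⟨rfl | rfl, hx⟩
    · exact absurd hδ hx
    · rfl

theorem isOfType (hT : IsYangLeeObject k 𝒢 T) (h𝒢 : 𝒢.IsFaithful) :
    IsOfType k C ![1, Real.goldenRatio]
      ![Nat.card (invertibles C), Nat.card (invertibles C)] where
  dim_zero := rfl
  dim_strictMono := by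
    rw [Fin.strictMono_iff_lt_succ]
    intro i
    fin_cases i
    exact Real.one_lt_goldenRatio
  mult_pos := by
    have := finite_irr k C
    obtain ⟨δ, -, -, hδ, -⟩ := hT.exists_irr_eq h𝒢 1
    have : Nonempty (invertibles C) := ⟨⟨δ, hδ⟩⟩
    rw [Fin.forall_fin_two]
    exact ⟨Nat.card_pos, Nat.card_pos⟩
  card_eq := by
    rw [Fin.forall_fin_two]
    constructor
    · exact Nat.card_congr (Equiv.subtypeEquivRight (hT.FPdim_eq_one_iff h𝒢))
    · refine (Nat.card_congr
        (Equiv.subtypeEquivRight (hT.FPdim_eq_goldenRatio_iff h𝒢))).trans ?_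
      rw [hT.natCard_not_invertibles h𝒢]
      exact (hT.natCard_invertibles h𝒢).symm
  exhaust x := by
    by_cases hx : x ∈ invertibles C
    · exact ⟨0, (hT.FPdim_eq_one_iff h𝒢 x).2 hx⟩
    · exact ⟨1, (hT.FPdim_eq_goldenRatio_iff h𝒢 x).2 hx⟩

/-- `T` occurs in `T ⊗ T`, so its class `t` satisfies `t * t = t`. -/
theorem universalDegree_eq_one (hT : IsYangLeeObject k 𝒢 T) :
    universalDegree (Irr.mk T hT.simple) = 1 := by
  have := hT.simple
  obtain ⟨e⟩ := Irr.nonempty_mk_obj_iso T hT.simple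
  rw [← mul_eq_left (a := universalDegree (Irr.mk T hT.simple))]
  refine universalDegree_mul (isSimpleConstituent_of_homDim (k := k) ?_)
  rw [homDim_congr e (e ⊗ᵢ e), ← hT.homDim_tensor_comm, hT.homDim_tensor_self, homDim_simple_self]
  omega

/-- The two simple objects of a component differ by a factor `T`, whose universal degree is trivial.
-/
theorem universalDegree_eq_of_degree_eq (hT : IsYangLeeObject k 𝒢 T) (h𝒢 : 𝒢.IsFaithful)
    {x y : Irr C} (h : 𝒢.degree x = 𝒢.degree y) : universalDegree x = universalDegree y := by
  obtain ⟨δ, t, hirr, -, -, ⟨e⟩⟩ := hT.exists_irr_eq h𝒢 (𝒢.degree x)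
  obtain ⟨f⟩ := Irr.nonempty_mk_obj_iso T hT.simple
  have ht : universalDegree t = universalDegree δ := by
    rw [← one_mul (universalDegree δ), ← hT.universalDegree_eq_one]
    exact (universalDegree_mul ⟨inferInstance, (e.trans (whiskerRightIso f.symm _)).hom,
      inferInstance⟩).symm
  have key : ∀ z, 𝒢.degree z = 𝒢.degree x → universalDegree z = universalDegree δ := by
    intro z hz
    have hz' : z ∈ 𝒢.irr (𝒢.degree x) := 𝒢.mem_irr_iff.2 hz
    rw [hirr] at hz'
    rcases hz' with rfl | rfl
    · rfl
    · exact ht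
  rw [key x rfl, key y h.symm]

theorem fromUniversal_bijective (hT : IsYangLeeObject k 𝒢 T) (h𝒢 : 𝒢.IsFaithful) :
    Function.Bijective 𝒢.fromUniversal := by
  choose δ y hirr hδ hy hiso using hT.exists_irr_eq h𝒢
  have hdeg : ∀ g, 𝒢.degree (δ g) = g := fun g => 𝒢.mem_irr_iff.1 (by rw [hirr g]; simp)
  -- The inverse sends `g` to the class of `δ g`. It is multiplicative because any constituent of `δ
  -- g ⊗ δ h` has the degree of `δ (g * h)`, hence the same universal degree.
  let ψ : G →* UniversalGradingGroup C := MonoidHom.mk' (fun g => universalDegree (δ g)) (by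
    intro g h
    have hnz : ¬ IsZero ((δ g).obj ⊗ (δ h).obj) := fun hz => by
      have h0 : homDim k ((δ g).obj ⊗ (δ h).obj) ((δ g).obj ⊗ (δ h).obj) = 0 :=
        homDim_eq_zero k fun f => hz.eq_of_src _ _
      rw [hT.homDim_tensor_left ((hT.mem_invertibles_iff _).1 (hδ g)), homDim_simple_self] at h0
      exact one_ne_zero h0
    obtain ⟨S, f, hS, hf⟩ := exists_simple_mono k hnz
    obtain ⟨e⟩ := Irr.nonempty_mk_obj_iso S hS
    have hc : IsSimpleConstituent (Irr.mk S hS).obj ((δ g).obj ⊗ (δ h).obj) :=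
      ⟨inferInstance, e.hom ≫ f, mono_comp _ _⟩
    rw [universalDegree_mul hc]
    refine hT.universalDegree_eq_of_degree_eq h𝒢 ?_
    rw [𝒢.degree_eq_mul hc, hdeg, hdeg, hdeg])
  have hleft : ψ.comp 𝒢.fromUniversal = MonoidHom.id _ := PresentedGroup.ext fun x => by
    change ψ (𝒢.fromUniversal (universalDegree x)) = universalDegree x
    rw [𝒢.fromUniversal_universalDegree]
    exact hT.universalDegree_eq_of_degree_eq h𝒢 (hdeg _)
  refine ⟨Function.LeftInverse.injective (g := ψ) fun a => DFunLike.congr_fun hleft a, fun g =>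
    ⟨universalDegree (δ g), ?_⟩⟩
  rw [𝒢.fromUniversal_universalDegree, hdeg]

/-- The trivial component of the grading is the adjoint subcategory. -/
theorem component_one_eq_adjointSubcategory (hT : IsYangLeeObject k 𝒢 T) :
    𝒢.component 1 = adjointSubcategory C := by
  have := hT.simple
  ext Z
  constructor
  · intro hZ P hP hPad
    -- `T` occurs in `T ⊗ Tᘁ` because it occurs in `T ⊗ T`.
    have hPT : P T := hPad T T hT.simple (isSimpleConstituent_of_homDim (k := k) (by
      rw [← homDim_tensorRight k _ _ T Tᘁ, hT.homDim_tensor_self, homDim_simple_self]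
      omega))
    obtain ⟨n, S, hS, ⟨e⟩⟩ := hC.semisimple Z
    refine hP.iso e.symm (hP.biproduct S fun i => ?_)
    have := hS i
    exact (hT.iso_or_iso (S i) (hS i) (𝒢.component_of_mono (biproduct.ι S i ≫ e.inv) hZ)).elim
      (fun ⟨a⟩ => hP.iso a.symm hP.unit) (fun ⟨a⟩ => hP.iso a.symm hPT)
  · intro hZ
    refine hZ _ (𝒢.isFusionSubcategory_component_one hT.unit_mem) ?_
    rintro X S hX ⟨hS, f, hf⟩
    obtain ⟨g, hg⟩ := 𝒢.exists_component_of_simple X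
    refine 𝒢.component_of_mono f ?_
    simpa using 𝒢.tensor hg (𝒢.component_rightDual hT.unit_mem hg)

end IsYangLeeObject

/-! ### Transport from the Yang–Lee category and conclusion -/

/-- A Yang–Lee category embedded as the trivial component of a grading provides a Yang–Lee
object. -/
theorem IsYangLee.exists_isYangLeeObject {k : Type*} [Field k] [IsAlgClosed k]
    {C : Type*} [Category* C] [Abelian C] [Linear k C] [MonoidalCategory C]
    [MonoidalPreadditive C] [MonoidalLinear k C] [RigidCategory C] [IsFusionCategory k C]
    {Y : Type*} [Category* Y] [Abelian Y] [Linear k Y] [MonoidalCategory Y]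
    [MonoidalPreadditive Y] [MonoidalLinear k Y] [RigidCategory Y] (hY : IsYangLee k Y)
    {G : Type*} [Group G] (𝒢 : Grading C G)
    (ι : Y ⥤ C) [ι.Monoidal] [ι.Additive] [ι.Linear k] [ι.Full] [ι.Faithful]
    (hι : ι.essImage = 𝒢.component 1) : ∃ T : C, IsYangLeeObject k 𝒢 T := by
  obtain ⟨hfus, X, hX, hne, hS, ⟨e⟩⟩ := hY
  have hmap : ∀ A B : Y, homDim k A B = homDim k (ι.obj A) (ι.obj B) := fun A B =>
    homDim_map k ι A B
  have := hfus.simple_unit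
  have := preservesBinaryBiproducts_of_preservesBiproducts ι
  let ε := Functor.Monoidal.εIso ι
  refine ⟨ι.obj X, ?_, ?_, ⟨?_⟩, ?_, ?_, ?_⟩
  · exact simple_of_homDim_self k (by rw [← hmap, homDim_simple_self])
  · rw [homDim_congr_right k _ ε, ← hmap, homDim_simple_of_isEmpty k hne]
  · exact (Functor.Monoidal.μIso ι X X).trans ((ι.mapIso e).trans
      ((ι.mapBiprod (𝟙_ Y) X).trans (biprod.mapIso ε.symm (Iso.refl _))))
  · rw [← hι]
    exact ⟨_, ⟨ε.symm⟩⟩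
  · rw [← hι]
    exact ι.obj_mem_essImage X
  · intro S hSs hmem
    rw [← hι] at hmem
    obtain ⟨A, ⟨a⟩⟩ := hmem
    -- Full faithfulness preserves the dimension of endomorphisms, which detects simplicity, so `ι`
    -- reflects simple objects.
    have hA : Simple A := simple_of_homDim_self k (by
      rw [hmap, homDim_congr a a, homDim_simple_self])
    exact (hS A hA).imp (fun ⟨b⟩ => ⟨a.symm.trans ((ι.mapIso b).trans ε.symm)⟩)
      (fun ⟨b⟩ => ⟨a.symm.trans (ι.mapIso b)⟩)

end Fusion

theorem mainTheorem3 {k : Type*} [Field k] [IsAlgClosed k] [CharZero k]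
    {C : Type*} [Category* C] [Abelian C] [Linear k C] [MonoidalCategory C]
    [MonoidalPreadditive C] [MonoidalLinear k C] [RigidCategory C]
    [Fusion.IsFusionCategory k C]
    {Y : Type*} [Category* Y] [Abelian Y] [Linear k Y] [MonoidalCategory Y]
    [MonoidalPreadditive Y] [MonoidalLinear k Y] [RigidCategory Y]
    (hY : Fusion.IsYangLee k Y)
    {G : Type*} [Group G] (𝒢 : Fusion.Grading C G) (h𝒢 : 𝒢.IsFaithful)
    -- the identification of `Y` with the trivial component of the grading
    (ι : Y ⥤ C) [ι.Monoidal] [ι.Additive] [ι.Linear k] [ι.Full] [ι.Faithful]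
    (hι : ι.essImage = 𝒢.component 1) :
    Fusion.IsOfType k C ![1, (1 + √5) / 2]
      ![Nat.card (Fusion.invertibles C), Nat.card (Fusion.invertibles C)] ∧
    (∀ g : G, (𝒢.irr g).ncard = 2 ∧ ∃ δ Yg : Fusion.Irr C, 𝒢.irr g = {δ, Yg} ∧
      δ ∈ Fusion.invertibles C ∧ Fusion.FPdim k δ = 1 ∧ Fusion.FPdim k Yg = (1 + √5) / 2) ∧
    ι.essImage = Fusion.adjointSubcategory C ∧
    (∃ φ : Fusion.UniversalGradingGroup C ≃* G, ∀ (g : G) (x : Fusion.Irr C),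
      x ∈ 𝒢.irr g ↔ φ (Fusion.universalDegree x) = g) ∧
    Nat.card (Fusion.UniversalGradingGroup C) = Nat.card (Fusion.invertibles C) := by
  obtain ⟨T, hT⟩ := hY.exists_isYangLeeObject 𝒢 ι hι
  -- `Real.goldenRatio` unfolds to `(1 + √5) / 2`, so the two forms agree definitionally.
  refine ⟨hT.isOfType h𝒢, fun g => ?_, hι.trans hT.component_one_eq_adjointSubcategory,
    ⟨MulEquiv.ofBijective 𝒢.fromUniversal (hT.fromUniversal_bijective h𝒢), fun g x => ?_⟩, ?_⟩
  · obtain ⟨δ, y, hirr, hδ, hy, -⟩ := hT.exists_irr_eq h𝒢 g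
    refine ⟨?_, δ, y, hirr, hδ, (hT.FPdim_eq_one_iff h𝒢 δ).2 hδ,
      (hT.FPdim_eq_goldenRatio_iff h𝒢 y).2 hy⟩
    rw [hirr, Set.ncard_pair]
    rintro rfl
    exact hy hδ
  · rw [𝒢.mem_irr_iff, ← 𝒢.fromUniversal_universalDegree]
    rfl
  · rw [hT.natCard_invertibles h𝒢]
    exact Nat.card_congr (Equiv.ofBijective _ (hT.fromUniversal_bijective h𝒢))
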